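/- **Setting.** Let $m\ge 1$ and let $\Omega\subset\mathbb R^3$ be a bounded domain with $\partial\Omega\in C^{1,\alpha}$ for some $0<\alpha\le1$ (near each of its points $\partial\Omega$ is the graph of a $C^{1,\alpha}$ function of two of the coordinates, with $\Omega$ on one side) and with $\overline\Omega$ convex; $n$ is the exterior unit normal and $dS$ the surface measure. Consider the Dirichlet problem for $u=(u_1,\dots,u_m)^T$, $$v_j=f_j(v_{m+1},\dots,v_{10m},X),\quad 1\le j\le m,\ X\in\overline\Omega,\qquad u|_{\partial\Omega}=A_1,$$ where $v_1,\dots,v_{10m}$ is a permutation of the components of $u,\ u_x,u_y,u_z,\ u_{xx},u_{xy},u_{xz},u_{yy},u_{yz},u_{zz}$, the $f_j$ are continuous on $\mathbb R^{9m}\times\overline\Omega$, and $A_1$ is the restriction to $\partial\Omega$ of a $C^2$ function on $\mathbb R^3$. Put $Z_1=(v_{m+1},\dots,v_{10m})^T$. Let $C$ be a real $m\times 9m$ matrix, $\psi(Z_1)(X)=f(Z_1(X),X)-CZ_1(X)$, and $Z=(Z_1,S)$ with $S=\psi(Z_1)$, so that $(v_1,\dots,v_m)^T=CZ_1+S$.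 Write $u=A_0Z$ and $\partial u=A_\partial Z$ for each of the nine derivatives $\partial=\partial_x,\partial_y,\partial_z,\partial_{xx},\partial_{xy},\partial_{xz},\partial_{yy},\partial_{yz},\partial_{zz}$; here $A_0,A_\partial$ are constant matrices. Let $B=(B_1,-B_2)$ be the $9m\times10m$ matrix whose block rows are $\sigma_\partial(i\xi)A_0-A_\partial$, where $\sigma_\partial(i\xi)$ is the symbol ($i\xi_j$ or $i\xi_ji\xi_k$) of $\partial$, $B_1$ having $9m$ columns. Assume that $C$ is such that $\det B_1\not\equiv0$ and that there is a polynomial $a_1\neq0$ in $i\xi$ such that $a_1B_1^{-1}$ is a polynomial matrix and, $a$ being the highest degree in $a_1B_1^{-1}$ and $a_1B_1^{-1}B_2$, $$(1+|\xi|^2)^{-a-3}B_1^{-1},\ (1+|\xi|^2)^{-a-3}B_1^{-1}B_2\in L^1(\mathbb R^3).$$ **The mollified operators.** Let $h(X)=\frac1{4\pi|X|}$, and let $\psi_1(Z_1)$ be the expression of $-\Delta u$ through $Z_1$ (each component of $u_{xx},u_{yy},u_{zz}$ is either a component of $Z_1$ or one of the $v_j$, $j\le m$, and in the latter case is replaced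 by $f_j(Z_1,X)$). For $Z_1\in C(\overline\Omega)$ let $A_5\in C(\partial\Omega)$ be the solution of $$\tfrac12A_5(P_0)=\int_{\partial\Omega}\nabla h(P_0-P)\cdot n_{P_0}\,A_5(P)\,dS_P+g_{02}(P_0)+\int_{\overline\Omega}\nabla h(P_0-Y)\cdot n_{P_0}\,\psi_1(Z_1)(Y)\,dY,\quad P_0\in\partial\Omega,$$ where $g_{02}(P_0)=\lim_{t\to0+}\partial_{n_{P_0}}g_{01}(P_0-tn_{P_0})$ and $g_{01}(M)=\int_{\partial\Omega}\nabla h(M-P)\cdot n_P\,A_1(P)\,dS_P$. Put $A_{k+1}=\partial_kA_1+(A_5-\partial_nA_1)n_k$ ($k=1,2,3$), $g_j(\xi)=\int_{\partial\Omega}A_1n_je^{-i\xi\cdot P}dS$, $g_{kj}(\xi)=\int_{\partial\Omega}A_{k+1}n_je^{-i\xi\cdot P}dS$, and let $\beta_1(\xi)$ be the vector with block $-g_j$ for $\partial_j$ and block $-g_{kj}-i\xi_jg_k$ for $\partial_j\partial_k$, $j\le k$. With $F(g)(\xi)=\int g(X)e^{-i\xi\cdot X}dX$, $\delta_\epsilon(X)=(\pi\epsilon)^{-3/2}e^{-|X|^2/\epsilon}$,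 $w_{1\epsilon}=F^{-1}(F(\delta_\epsilon)B_1^{-1}\beta_1)$ and $w_{2\epsilon}=F^{-1}(F(\delta_\epsilon)B_1^{-1}B_2)$, define for $\epsilon>0$ $$T_{0\epsilon}(Z_1)(X)=w_{1\epsilon}(X)+\int_{\overline\Omega}w_{2\epsilon}(X-Y)\,\psi(Z_1)(Y)\,dY,\qquad X\in\overline\Omega.$$ Fix $M>0$ and let $\Omega_M=\{Z_1\in C(\overline\Omega;\mathbb R^{9m}):\max_{1\le i\le9m}\max_{\overline\Omega}|Z_{1,i}|<M\}$. **Theorem 4.4.** Suppose there are $\epsilon_k>0$, $\epsilon_k\to0$, and $Z_{1\epsilon_k}\in\Omega_M$ with $Z_{1\epsilon_k}=T_{0\epsilon_k}(Z_{1\epsilon_k})$ on $\overline\Omega$ for all $k$, such that for every $c>0$ there is $d>0$ such that for all $k,l$ and all $1\le i\le9m$ $$m\big(\Omega^+_{k,l,i}(d)\cup\Omega^-_{k,l,i}(d)\big)\le c,$$ where $m$ is Lebesgue measure, $\Omega^+_{k,l,i}=\{X\in\overline\Omega: Z_{1,i,\epsilon_k}(X)-Z_{1,i,\epsilon_l}(X)\ge0\}$,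 $\Omega^-_{k,l,i}=\{X\in\overline\Omega: Z_{1,i,\epsilon_k}(X)-Z_{1,i,\epsilon_l}(X)<0\}$ and $\Omega^\pm_{k,l,i}(d)=\{X\in\overline\Omega:\operatorname{dist}(X,\partial\Omega^\pm_{k,l,i})\le d\}$, with boundaries taken in $\mathbb R^3$ and $\operatorname{dist}(X,\emptyset)=+\infty$. Then there exist $\epsilon'_k>0$, $\epsilon'_k\to0$, and $Z'_k\in\Omega_M$ with $Z'_k=T_{0\epsilon'_k}(Z'_k)$ on $\overline\Omega$ for all $k$, such that $\lim_{k\to\infty}Z'_k(X)$ exists for almost every $X\in\overline\Omega$. -/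

import Mathlib

open MeasureTheory Set Filter Topology

namespace ResolvedPDE

noncomputable section

/-- Euclidean three-space; its `volume` is Lebesgue measure. -/
abbrev E3 : Type := EuclideanSpace ℝ (Fin 3)

/-! ### Bounded domains with `C^{1,α}` boundary, outward normal, surface integrals -/

/-- The two coordinates of `P` other than the `k`-th one. -/
def dropCoord (k : Fin 3) (P : E3) : EuclideanSpace ℝ (Fin 2) :=
  WithLp.toLp 2 fun j => P (k.succAbove j)

/-- `∂Ω ∈ C^{1,α}`: near each of its points, `∂Ω` is the graph of a `C^{1,α}` function of two of the
three coordinates, with `Ω` lying exactly on one side of the graph. -/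
def HasC1HolderBoundary (Ω : Set E3) (α : NNReal) : Prop :=
  ∀ P₀ ∈ frontier Ω, ∃ δ > (0 : ℝ), ∃ k : Fin 3, ∃ s : ℝ, (s = 1 ∨ s = -1) ∧
    ∃ φ : EuclideanSpace ℝ (Fin 2) → ℝ,
      ContDiff ℝ 1 φ ∧ (∃ K : NNReal, HolderWith K α (fderiv ℝ φ)) ∧
      ∀ P ∈ Metric.ball P₀ δ,
        (P ∈ frontier Ω ↔ P k = φ (dropCoord k P)) ∧
        (P ∈ Ω ↔ s * (P k - φ (dropCoord k P)) < 0)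

/-- `n` is the exterior unit normal to `∂Ω` at `P`: a unit vector orthogonal to the tangent plane,
with `Ω` on the side of `-n` and the complement of `closure Ω` on the side of `n`. -/
def IsOuterNormal (Ω : Set E3) (P n : E3) : Prop :=
  ‖n‖ = 1 ∧
  (fun Q : E3 => inner ℝ (Q - P) n) =o[𝓝[frontier Ω] P] (fun Q : E3 => Q - P) ∧
  ∀ᶠ t : ℝ in 𝓝[>] 0, P - t • n ∈ Ω ∧ P + t • n ∉ closure Ω

open Classical in
/-- The exterior unit normal field (at a boundary point of a `C^{1,α}` domain the vector satisfying
`IsOuterNormal` exists and is unique; the value elsewhere is irrelevant). -/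
def outerNormal (Ω : Set E3) (P : E3) : E3 :=
  if h : ∃ n, IsOuterNormal Ω P n then h.choose else 0

/-- The surface measure `dS` on `∂Ω`: two-dimensional Hausdorff measure, normalized so as to be
area on planes. -/
def surface (Ω : Set E3) : Measure E3 := (μHE[2] : Measure E3).restrict (frontier Ω)

/-! ### Fourier integrals -/

/-- `F(g)(ξ) = ∫ g(X) e^{-i ξ·X} dX`. -/
def fourierR3 (g : E3 → ℂ) (ξ : E3) : ℂ :=
  ∫ X : E3, g X * Complex.exp (-(Complex.I * ((inner ℝ ξ X : ℝ) : ℂ)))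

/-- `F⁻¹(g)(X) = (2π)⁻³ ∫ g(ξ) e^{i ξ·X} dξ`. -/
def invFourierR3 (g : E3 → ℂ) (X : E3) : ℂ :=
  (1 / (2 * (Real.pi : ℂ)) ^ 3) *
    ∫ ξ : E3, g ξ * Complex.exp (Complex.I * ((inner ℝ ξ X : ℝ) : ℂ))

/-- `∫_{∂Ω} g(P) e^{-i ξ·P} dS`. -/
def surfaceFourier (Ω : Set E3) (g : E3 → ℝ) (ξ : E3) : ℂ :=
  ∫ P, (g P : ℂ) * Complex.exp (-(Complex.I * ((inner ℝ ξ P : ℝ) : ℂ))) ∂(surface Ω)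

/-- The Gaussian mollifier `δ_ε(X) = (√(π ε))⁻³ e^{-|X|²/ε}`. -/
def mollifier (ε : ℝ) (X : E3) : ℝ :=
  1 / Real.sqrt (Real.pi * ε) ^ 3 * Real.exp (-‖X‖ ^ 2 / ε)

/-- `h(X) = 1 / (4π|X|)`. -/
def newton (X : E3) : ℝ := 1 / (4 * Real.pi * ‖X‖)

/-! ### The data of the Dirichlet problem -/

/-- The data of the problem for an unknown `u` with `m` components.
The components of `(u, ∂u, ∂²u)` are indexed by `Fin 10 × Fin m`: the pair `(s, c)` stands for the
`c`-th component of the `s`-th entry of the list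
`u, u_x, u_y, u_z, u_xx, u_xy, u_xz, u_yy, u_yz, u_zz`.
The quantities `v_1, …, v_{10m}` are also indexed by `Fin 10 × Fin m`, in blocks of `m`: block `0`
consists of the resolved quantities `v_1, …, v_m`, and the blocks `1, …, 9` form `Z₁`. -/
structure Data (m : ℕ) where
  /-- the domain -/
  Ω : Set E3
  /-- the right-hand sides `f_j(v_{m+1}, …, v_{10m}, X)` -/
  f : (Fin 9 × Fin m → ℝ) → E3 → Fin m → ℝ
  /-- the quantity `v_p` is the entry `σ p` of `(u, ∂u, ∂²u)` -/
  σ : Equiv.Perm (Fin 10 × Fin m)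
  /-- the boundary values of `u`, given as the restriction to `∂Ω` of a function on `ℝ³` -/
  A₁ : E3 → Fin m → ℝ
  /-- the parameters `(C_1, …, C_9)` -/
  C : Matrix (Fin m) (Fin 9 × Fin m) ℝ

/-- The derivatives `x, y, z, xx, xy, xz, yy, yz, zz`, in this order. -/
def derivTable : Fin 9 → Fin 3 ⊕ (Fin 3 × Fin 3) :=
  ![.inl 0, .inl 1, .inl 2, .inr (0, 0), .inr (0, 1), .inr (0, 2), .inr (1, 1), .inr (1, 2),
    .inr (2, 2)]

/-- The symbols `iξ_j` and `iξ_j iξ_k`, as polynomials in `iξ_1, iξ_2, iξ_3`. -/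
def symb (s : Fin 9) : MvPolynomial (Fin 3) ℂ :=
  match derivTable s with
  | .inl j => MvPolynomial.X j
  | .inr (j, k) => MvPolynomial.X j * MvPolynomial.X k

/-- The value at `ξ` of a polynomial in `iξ_1, iξ_2, iξ_3`. -/
def evalI (p : MvPolynomial (Fin 3) ℂ) (ξ : E3) : ℂ :=
  MvPolynomial.eval (fun j => Complex.I * (ξ j : ℂ)) p

namespace Data

variable {m : ℕ} (D : Data m)

/-- `Z = (Z₁, S)` with `V₁ = C Z₁ + S`. For an entry `q` of `(u, ∂u, ∂²u)`, the coefficient of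
`Z₁`'s `r`-th component in the expression of that entry through `Z`. -/
def rowZ (q : Fin 10 × Fin m) (r : Fin 9 × Fin m) : ℝ :=
  Fin.cases (D.C (D.σ.symm q).2 r)
    (fun l => if (l, (D.σ.symm q).2) = r then 1 else 0) (D.σ.symm q).1

/-- The coefficient of the `j`-th component of `S` in the expression of the entry `q` through `Z`. -/
def rowS (q : Fin 10 × Fin m) (j : Fin m) : ℝ :=
  Fin.cases (if (D.σ.symm q).2 = j then 1 else 0) (fun _ => 0) (D.σ.symm q).1

/-- The matrix `B₁`: the first `9m` columns of the matrix `B` with block rows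
`(symbol of ∂) A₀ - A_∂`, for the nine derivatives `∂`. -/
def B₁ : Matrix (Fin 9 × Fin m) (Fin 9 × Fin m) (MvPolynomial (Fin 3) ℂ) :=
  fun p r => symb p.1 * MvPolynomial.C (D.rowZ (0, p.2) r : ℂ)
    - MvPolynomial.C (D.rowZ (p.1.succ, p.2) r : ℂ)

/-- The matrix `B₂`: minus the last `m` columns of `B`. -/
def B₂ : Matrix (Fin 9 × Fin m) (Fin m) (MvPolynomial (Fin 3) ℂ) :=
  fun p j => MvPolynomial.C (D.rowS (p.1.succ, p.2) j : ℂ)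
    - symb p.1 * MvPolynomial.C (D.rowS (0, p.2) j : ℂ)

/-- `B₁(ξ)⁻¹` (defined off the null set where `det B₁(ξ) = 0`). -/
def B₁inv (ξ : E3) : Matrix (Fin 9 × Fin m) (Fin 9 × Fin m) ℂ :=
  (D.B₁.map fun p => evalI p ξ)⁻¹

/-- `B₁(ξ)⁻¹ B₂(ξ)`. -/
def B₁invB₂ (ξ : E3) : Matrix (Fin 9 × Fin m) (Fin m) ℂ :=
  D.B₁inv ξ * D.B₂.map fun p => evalI p ξ

/-- The condition on the parameters: `det B₁ ≠ 0`, and there are a polynomial `a₁ ≠ 0` and a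
polynomial matrix `Q = a₁ B₁⁻¹` such that, `a` being the highest degree in `a₁ B₁⁻¹` and
`a₁ B₁⁻¹ B₂`, the functions `(1+|ξ|²)^{-a-3} B₁⁻¹` and `(1+|ξ|²)^{-a-3} B₁⁻¹ B₂` are in `L¹`. -/
def AdmissibleParameters : Prop :=
  D.B₁.det ≠ 0 ∧
  ∃ (a₁ : MvPolynomial (Fin 3) ℂ)
    (Q : Matrix (Fin 9 × Fin m) (Fin 9 × Fin m) (MvPolynomial (Fin 3) ℂ)) (a : ℕ),
    a₁ ≠ 0 ∧ D.B₁ * Q = Matrix.scalar _ a₁ ∧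
    a = max (Finset.univ.sup fun p : (Fin 9 × Fin m) × (Fin 9 × Fin m) => (Q p.1 p.2).totalDegree)
      (Finset.univ.sup fun p : (Fin 9 × Fin m) × Fin m => ((Q * D.B₂) p.1 p.2).totalDegree) ∧
    (∀ p r, Integrable fun ξ : E3 => ((1 + ‖ξ‖ ^ 2 : ℝ) : ℂ)⁻¹ ^ (a + 3) * D.B₁inv ξ p r) ∧
    (∀ p j, Integrable fun ξ : E3 => ((1 + ‖ξ‖ ^ 2 : ℝ) : ℂ)⁻¹ ^ (a + 3) * D.B₁invB₂ ξ p j)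

/-- The standing assumptions on the data. -/
structure Standing : Prop where
  isOpen : IsOpen D.Ω
  connected : IsConnected D.Ω
  bounded : Bornology.IsBounded D.Ω
  boundary : ∃ α : NNReal, 0 < α ∧ α ≤ 1 ∧ HasC1HolderBoundary D.Ω α
  convex : Convex ℝ (closure D.Ω)
  f_cont : ContinuousOn (fun q : (Fin 9 × Fin m → ℝ) × E3 => D.f q.1 q.2) (univ ×ˢ closure D.Ω)
  A₁_smooth : ContDiff ℝ 2 D.A₁
  parameters : D.AdmissibleParameters

/-! ### The operator `T_{0ε}` -/

/-- `ψ(Z₁)(X) = f(Z₁(X), X) - C Z₁(X)`. -/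
def ψ (Z : E3 → Fin 9 × Fin m → ℝ) (X : E3) (j : Fin m) : ℝ :=
  D.f (Z X) X j - (D.C.mulVec (Z X)) j

/-- The entry `q` of `(u, ∂u, ∂²u)` at `X`, expressed through `Z₁`: a component of `Z₁`, or a value
of `f` if it is one of the resolved quantities. -/
def entry (Z : E3 → Fin 9 × Fin m → ℝ) (X : E3) (q : Fin 10 × Fin m) : ℝ :=
  Fin.cases (D.f (Z X) X (D.σ.symm q).2) (fun l => Z X (l, (D.σ.symm q).2)) (D.σ.symm q).1

/-- `ψ₁(Z₁)`, the expression of `-Δu = -(u_xx + u_yy + u_zz)` through `Z₁`. -/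
def ψ₁ (Z : E3 → Fin 9 × Fin m → ℝ) (X : E3) (c : Fin m) : ℝ :=
  -(D.entry Z X (4, c) + D.entry Z X (7, c) + D.entry Z X (9, c))

/-- The potential `∫_{∂Ω} (∇h(M - P) · n_P) A₁(P) dS_P`. -/
def doubleLayer (c : Fin m) (M : E3) : ℝ :=
  ∫ P, fderiv ℝ newton (M - P) (outerNormal D.Ω P) * D.A₁ P c ∂(surface D.Ω)

/-- `A₅` is the exterior normal derivative on `∂Ω` determined by `Z₁` and `A₁`: the continuous
solution of the Fredholm equation
`A₅/2 = (∂h/∂n_{P₀}) ∗_{∂Ω} A₅ + g₀₂ + (∂h/∂n_{P₀}) ∗ ψ₁(Z₁)` on `∂Ω`, where `g₀₂(P₀)` is the limit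
at `P₀`, from the interior along the normal `n_{P₀}`, of the derivative of `doubleLayer` in the
direction `n_{P₀}`. -/
def IsNormalData (Z : E3 → Fin 9 × Fin m → ℝ) (A₅ : E3 → Fin m → ℝ) : Prop :=
  ContinuousOn A₅ (frontier D.Ω) ∧
  ∃ g₀₂ : E3 → Fin m → ℝ, ∀ P₀ ∈ frontier D.Ω, ∀ c : Fin m,
    Tendsto
      (fun t : ℝ => lineDeriv ℝ (D.doubleLayer c) (P₀ - t • outerNormal D.Ω P₀)
        (outerNormal D.Ω P₀))
      (𝓝[>] 0) (𝓝 (g₀₂ P₀ c)) ∧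
    A₅ P₀ c / 2 =
      (∫ P, fderiv ℝ newton (P₀ - P) (outerNormal D.Ω P₀) * A₅ P c ∂(surface D.Ω))
      + g₀₂ P₀ c
      + ∫ Y in closure D.Ω, fderiv ℝ newton (P₀ - Y) (outerNormal D.Ω P₀) * D.ψ₁ Z Y c

/-- The boundary values of `∂u/∂x_k` (`A₂, A₃, A₄` for `k = 0, 1, 2`):
`∂A₁/∂x_k + (A₅ - ∂A₁/∂n) n_k`. -/
def gradData (A₅ : E3 → Fin m → ℝ) (k : Fin 3) (P : E3) (c : Fin m) : ℝ :=
  fderiv ℝ D.A₁ P (EuclideanSpace.single k 1) c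
    + (A₅ P c - fderiv ℝ D.A₁ P (outerNormal D.Ω P) c) * outerNormal D.Ω P k

/-- `g_j = ∫_{∂Ω} A₁ n_j e^{-iξ·P} dS`. -/
def g (j : Fin 3) (c : Fin m) (ξ : E3) : ℂ :=
  surfaceFourier D.Ω (fun P => D.A₁ P c * outerNormal D.Ω P j) ξ

/-- `∫_{∂Ω} (∂u/∂x_k) n_j e^{-iξ·P} dS`. -/
def gg (A₅ : E3 → Fin m → ℝ) (k j : Fin 3) (c : Fin m) (ξ : E3) : ℂ :=
  surfaceFourier D.Ω (fun P => D.gradData A₅ k P c * outerNormal D.Ω P j) ξ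

/-- The vector `β₁`, with blocks `-g_j` for `∂/∂x_j` and `-g_{kj} - iξ_j g_k` for
`∂²/∂x_j∂x_k`, `j ≤ k`. -/
def β₁ (A₅ : E3 → Fin m → ℝ) (ξ : E3) (p : Fin 9 × Fin m) : ℂ :=
  match derivTable p.1 with
  | .inl j => -D.g j p.2 ξ
  | .inr (j, k) => -D.gg A₅ k j p.2 ξ - Complex.I * (ξ j : ℂ) * D.g k p.2 ξ

/-- `w_{1ε} = F⁻¹(F(δ_ε) B₁⁻¹ β₁)`. -/
def w₁ (ε : ℝ) (A₅ : E3 → Fin m → ℝ) (X : E3) (p : Fin 9 × Fin m) : ℂ :=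
  invFourierR3 (fun ξ => fourierR3 (fun Y => (mollifier ε Y : ℂ)) ξ *
    ((D.B₁inv ξ).mulVec (D.β₁ A₅ ξ)) p) X

/-- `w_{2ε} = F⁻¹(F(δ_ε) B₁⁻¹ B₂)`. -/
def w₂ (ε : ℝ) (X : E3) : Matrix (Fin 9 × Fin m) (Fin m) ℂ :=
  fun p j => invFourierR3 (fun ξ => fourierR3 (fun Y => (mollifier ε Y : ℂ)) ξ *
    D.B₁invB₂ ξ p j) X

/-- `T_{0ε}(Z₁) = w_{1ε} + w_{2ε} ∗ (ψ(Z₁) I_{closure Ω})`, where `A₅` is the normal derivative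
belonging to `Z₁`. -/
def T₀ (ε : ℝ) (A₅ : E3 → Fin m → ℝ) (Z : E3 → Fin 9 × Fin m → ℝ) (X : E3)
    (p : Fin 9 × Fin m) : ℂ :=
  D.w₁ ε A₅ X p + ∫ Y in closure D.Ω, ∑ j, D.w₂ ε (X - Y) p j * (D.ψ Z Y j : ℂ)

/-- `Z₁ ∈ Ω_M` and `Z₁ = T_{0ε}(Z₁)` on `closure Ω`: `Z₁` is continuous on the compact set
`closure Ω` and each of its components has maximum norm less than `M` there. -/
def IsMollifiedSolution (M ε : ℝ) (Z : E3 → Fin 9 × Fin m → ℝ) : Prop :=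
  ContinuousOn Z (closure D.Ω) ∧
  (∀ X ∈ closure D.Ω, ∀ p, |Z X p| < M) ∧
  ∃ A₅ : E3 → Fin m → ℝ, D.IsNormalData Z A₅ ∧
    ∀ X ∈ closure D.Ω, ∀ p, (Z X p : ℂ) = D.T₀ ε A₅ Z X p

/-- `ε_k > 0`, `ε_k → 0`, and `Z_k ∈ Ω_M` solves `Z_k = T_{0ε_k}(Z_k)` for every `k`. -/
def IsSolutionSequence (M : ℝ) (ε : ℕ → ℝ) (Z : ℕ → E3 → Fin 9 × Fin m → ℝ) : Prop :=
  (∀ k, 0 < ε k) ∧ Tendsto ε atTop (𝓝 0) ∧ ∀ k, D.IsMollifiedSolution M (ε k) (Z k)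

/-- The set of `X ∈ closure Ω` where the `i`-th component of `Z - W` is nonnegative. -/
def signPos (Z W : E3 → Fin 9 × Fin m → ℝ) (i : Fin 9 × Fin m) : Set E3 :=
  {X ∈ closure D.Ω | 0 ≤ Z X i - W X i}

/-- The set of `X ∈ closure Ω` where the `i`-th component of `Z - W` is negative. -/
def signNeg (Z W : E3 → Fin 9 × Fin m → ℝ) (i : Fin 9 × Fin m) : Set E3 :=
  {X ∈ closure D.Ω | Z X i - W X i < 0}

/-- `{X ∈ closure Ω : dist(X, ∂S) ≤ d}`, the distance to the empty set being `+∞`. -/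
def nearBoundary (S : Set E3) (d : ℝ) : Set E3 :=
  {X ∈ closure D.Ω | Metric.infEDist X (frontier S) ≤ ENNReal.ofReal d}

end Data

end

end ResolvedPDE

/-! Being a bounded solution of the mollified equation is a condition on each index separately, so
it suffices to extract an almost everywhere convergent subsequence; this is a compactness argument
in `L¹`. By a diagonal argument, the integrals over countably many small cells converge along one
subsequence. This weak information controls `∫ |g|` for a difference `g` of two terms. If the ball
containing a cell misses the boundary of `{g ≥ 0}`, then `g` has one sign on the cell and `∫ |g| =
|∫ g|` there. Otherwise the whole cell lies near that boundary, and such cells have small total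
measure by hypothesis (`setIntegral_abs_le_sum`). Hence the subsequence is Cauchy in `L¹`
(`exists_subseq_setIntegral_abs_sub_lt`), and a further subsequence converges almost everywhere. -/

/-- A preconnected set that does not meet the frontier of `A` lies in `A` or is disjoint from it. -/
theorem IsPreconnected.subset_or_disjoint_of_disjoint_frontier {X : Type*} [TopologicalSpace X]
    {B A : Set X} (hB : IsPreconnected B) (h : Disjoint B (frontier A)) :
    B ⊆ A ∨ Disjoint B A := by
  have hcov : B ⊆ interior A ∪ (closure A)ᶜ := by
    intro x hx
    by_cases hi : x ∈ interior A
    · exact Or.inl hi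
    · exact Or.inr fun hc => disjoint_left.1 h hx ⟨hc, hi⟩
  have hdisj : Disjoint (interior A) (closure A)ᶜ :=
    disjoint_compl_right.mono_left (interior_subset.trans subset_closure)
  rcases hB.subset_or_subset isOpen_interior isClosed_closure.isOpen_compl hdisj hcov with hs | hs
  · exact Or.inl (hs.trans interior_subset)
  · exact Or.inr (disjoint_left.2 fun x hx hA => hs hx (subset_closure hA))

/-- Coordinatewise bounded sequences in a countable product of lines have convergent
subsequences. -/
theorem exists_subseq_forall_tendsto_of_abs_le {J : Type*} [Countable J] (a : ℕ → J → ℝ)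
    (R : J → ℝ) (ha : ∀ n j, |a n j| ≤ R j) :
    ∃ φ : ℕ → ℕ, StrictMono φ ∧ ∀ j, ∃ l, Tendsto (fun n => a (φ n) j) atTop (𝓝 l) := by
  -- Tychonoff; countability of `J` makes the product first countable, so compactness yields
  -- convergent subsequences.
  have hK : IsCompact (univ.pi fun j => Icc (-R j) (R j)) := isCompact_univ_pi fun _ => isCompact_Icc
  obtain ⟨l, -, φ, hφ, hl⟩ := hK.tendsto_subseq (x := a) fun n j _ => abs_le.1 (ha n j)
  exact ⟨φ, hφ, fun j => ⟨l j, tendsto_pi_nhds.1 hl j⟩⟩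

/-! ### Sign sets and `L¹` estimates -/

section SignChange

variable {E : Type*} [NormedAddCommGroup E] [NormedSpace ℝ E] [MeasurableSpace E] [BorelSpace E]
  {μ : Measure E} {K : Set E}

/-- On a piece of diameter at most `d` the integral of `|f|` is controlled by the integral of `f`,
up to the contribution of the points within `d` of the boundary of `{f ≥ 0}`. -/
theorem setIntegral_abs_le_of_subset_ball [IsFiniteMeasureOnCompacts μ] (hK : IsCompact K)
    {f : E → ℝ} {b : ℝ} (hb : ∀ x ∈ K, |f x| ≤ b) {D : Set E}
    (hD : MeasurableSet D) {x₀ : E} {r d : ℝ} (hr : 2 * r ≤ d) (hDr : D ⊆ Metric.ball x₀ r) :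
    ∫ x in K ∩ D, |f x| ∂μ ≤ |∫ x in K ∩ D, f x ∂μ| +
      b * μ.real ({x ∈ K | Metric.infEDist x (frontier {x ∈ K | 0 ≤ f x}) ≤ ENNReal.ofReal d}
        ∩ D) := by
  set A := {x ∈ K | 0 ≤ f x} with hA
  have hKD : MeasurableSet (K ∩ D) := hK.measurableSet.inter hD
  -- The dichotomy concerns the ball because it is connected, which `K ∩ D` need not be.
  by_cases hm : Disjoint (Metric.ball x₀ r) (frontier A)
  -- A point of `K` is needed to know `0 ≤ b`.
  · rcases (K ∩ D).eq_empty_or_nonempty with he | ⟨y, hyK, -⟩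
    · have : {x ∈ K | Metric.infEDist x (frontier A) ≤ ENNReal.ofReal d} ∩ D ⊆ ∅ :=
        he ▸ inter_subset_inter_left _ (sep_subset _ _)
      simp [he, subset_empty_iff.1 this]
    have hb0 : 0 ≤ b := (abs_nonneg _).trans (hb y hyK)
    have key : ∫ x in K ∩ D, |f x| ∂μ ≤ |∫ x in K ∩ D, f x ∂μ| := by
      rcases (convex_ball x₀ r).isPreconnected.subset_or_disjoint_of_disjoint_frontier hm
        with hs | hs
      · rw [setIntegral_congr_fun hKD fun x hx => abs_of_nonneg (hs (hDr hx.2)).2]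
        exact le_abs_self _
      · have hneg : ∀ x ∈ K ∩ D, |f x| = -f x := fun x hx =>
          abs_of_nonpos (le_of_not_ge fun h0 => disjoint_left.1 hs (hDr hx.2) ⟨hx.1, h0⟩)
        rw [setIntegral_congr_fun hKD hneg, integral_neg]
        exact neg_le_abs _
    have : 0 ≤ b * μ.real ({x ∈ K | Metric.infEDist x (frontier A) ≤ ENNReal.ofReal d} ∩ D) :=
      mul_nonneg hb0 measureReal_nonneg
    linarith
  · obtain ⟨z, hz, hzA⟩ := not_disjoint_iff.1 hm
    -- Two points of the ball are less than `2 * r ≤ d` apart, so one frontier point in it puts all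
    -- of `K ∩ D` in the neighbourhood.
    have hsub : {x ∈ K | Metric.infEDist x (frontier A) ≤ ENNReal.ofReal d} ∩ D = K ∩ D := by
      refine Subset.antisymm (inter_subset_inter_left _ (sep_subset _ _)) fun x hx =>
        ⟨⟨hx.1, (Metric.infEDist_le_edist_of_mem hzA).trans ?_⟩, hx.2⟩
      rw [edist_dist]
      refine ENNReal.ofReal_le_ofReal ?_
      have h1 := Metric.mem_ball.1 (hDr hx.2)
      have h2 := Metric.mem_ball'.1 hz
      linarith [dist_triangle x x₀ z]
    rw [hsub]
    have hfin : μ (K ∩ D) < ⊤ := (measure_mono inter_subset_left).trans_lt hK.measure_lt_top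
    have h1 : ‖∫ x in K ∩ D, |f x| ∂μ‖ ≤ b * μ.real (K ∩ D) :=
      norm_setIntegral_le_of_norm_le_const hfin fun x hx => by simpa using hb x hx.1
    linarith [le_abs_self (∫ x in K ∩ D, |f x| ∂μ), abs_nonneg (∫ x in K ∩ D, f x ∂μ),
      Real.norm_eq_abs (∫ x in K ∩ D, |f x| ∂μ)]

/-- The estimate of `setIntegral_abs_le_of_subset_ball`, summed over a finite partition. -/
theorem setIntegral_abs_le_sum [IsFiniteMeasureOnCompacts μ] (hK : IsCompact K)
    {f : E → ℝ} (hf : ContinuousOn f K) {b : ℝ} (hb : ∀ x ∈ K, |f x| ≤ b) {J : Type*}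
    (s : Finset J) {D : J → Set E} (hD : ∀ j, MeasurableSet (D j))
    (hdisj : Pairwise (Function.onFun Disjoint D)) (hcov : K ⊆ ⋃ j ∈ s, D j) {x₀ : J → E} {r d : ℝ}
    (hr : 2 * r ≤ d) (hDr : ∀ j, D j ⊆ Metric.ball (x₀ j) r) :
    ∫ x in K, |f x| ∂μ ≤ ∑ j ∈ s, |∫ x in K ∩ D j, f x ∂μ| +
      b * μ.real {x ∈ K | Metric.infEDist x (frontier {x ∈ K | 0 ≤ f x}) ≤ ENNReal.ofReal d} := by
  set N := {x ∈ K | Metric.infEDist x (frontier {x ∈ K | 0 ≤ f x}) ≤ ENNReal.ofReal d} with hN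
  have hNm : MeasurableSet N := hK.measurableSet.inter
    (isClosed_le Metric.continuous_infEDist continuous_const).measurableSet
  have hNK : N ⊆ K := sep_subset _ _
  have split : ∀ S : Set E, S ⊆ K → S = ⋃ j ∈ s, S ∩ D j := fun S hS => by
    rw [← inter_iUnion₂, inter_eq_left.2 (hS.trans hcov)]
  have hpd : ∀ S : Set E, (s : Set J).Pairwise (Function.onFun Disjoint fun j => S ∩ D j) :=
    fun S i _ j _ hij => (hdisj hij).mono inter_subset_right inter_subset_right
  have hint : IntegrableOn (fun x => |f x|) K μ := hf.abs.integrableOn_compact hK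
  have e1 : ∫ x in K, |f x| ∂μ = ∑ j ∈ s, ∫ x in K ∩ D j, |f x| ∂μ := by
    conv_lhs => rw [split K Subset.rfl]
    exact integral_biUnion_finset s (fun j _ => hK.measurableSet.inter (hD j)) (hpd K)
      fun j _ => hint.mono_set inter_subset_left
  have e2 : μ.real N = ∑ j ∈ s, μ.real (N ∩ D j) := by
    conv_lhs => rw [split N hNK]
    exact measureReal_biUnion_finset (hpd N) (fun j _ => hNm.inter (hD j))
      fun j _ => ((measure_mono (inter_subset_left.trans hNK)).trans_lt hK.measure_lt_top).ne
  rw [e1, e2, Finset.mul_sum, ← Finset.sum_add_distrib]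
  exact Finset.sum_le_sum fun j _ =>
    setIntegral_abs_le_of_subset_ball hK hb (hD j) hr (hDr j)

/-- A sequence of uniformly bounded continuous functions on a compact set, such that the
neighbourhoods of the boundaries of the sets `{f k ≥ f l}` have uniformly small measure, has a
subsequence that is Cauchy in `L¹`, simultaneously for finitely many such sequences. -/
theorem exists_subseq_setIntegral_abs_sub_lt [SecondCountableTopology E]
    [IsFiniteMeasureOnCompacts μ] (hK : IsCompact K) {ι : Type*} [Finite ι]
    {f : ℕ → ι → E → ℝ} (hf : ∀ k i, ContinuousOn (f k i) K) {b : ℝ}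
    (hb : ∀ k i, ∀ x ∈ K, |f k i x| ≤ b)
    (hsmall : ∀ c : ℝ, 0 < c → ∃ d : ℝ, 0 < d ∧ ∀ k l i,
      μ {x ∈ K | Metric.infEDist x (frontier {x ∈ K | 0 ≤ f k i x - f l i x}) ≤ ENNReal.ofReal d}
        ≤ ENNReal.ofReal c) :
    ∃ φ : ℕ → ℕ, StrictMono φ ∧ ∀ η : ℝ, 0 < η → ∃ n₀, ∀ k ≥ n₀, ∀ l ≥ n₀, ∀ i,
      ∫ x in K, |f (φ k) i x - f (φ l) i x| ∂μ < η := by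
  let x := TopologicalSpace.denseSeq E
  -- One partition for each scale `1 / (n + 1)`: the scale needed later depends on `η`, while the
  -- subsequence must not. All cells together are still countable.
  let D : ℕ → ℕ → Set E := fun n => disjointed fun j => Metric.ball (x j) (1 / ((n : ℝ) + 1))
  have hDm : ∀ n j, MeasurableSet (D n j) := fun n =>
    MeasurableSet.disjointed fun j => measurableSet_ball
  have hDb : ∀ n j, D n j ⊆ Metric.ball (x j) (1 / ((n : ℝ) + 1)) := fun n j =>
    disjointed_subset _ j
  obtain ⟨φ, hφ, hlim⟩ := exists_subseq_forall_tendsto_of_abs_le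
    (fun k (p : (ℕ × ℕ) × ι) => ∫ x in K ∩ D p.1.1 p.1.2, f k p.2 x ∂μ)
    (fun p => b * μ.real (K ∩ D p.1.1 p.1.2)) fun k p => by
      rw [← Real.norm_eq_abs]
      exact norm_setIntegral_le_of_norm_le_const
        ((measure_mono inter_subset_left).trans_lt hK.measure_lt_top)
        fun x hx => hb k p.2 x hx.1
  refine ⟨φ, hφ, fun η hη => ?_⟩
  -- Differences are bounded by `2 * |b|`; the added `1` keeps the divisor positive.
  have hB : 0 < 2 * |b| + 1 := by positivity
  obtain ⟨d, hd, hsm⟩ := hsmall (η / 2 / (2 * |b| + 1)) (by positivity)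
  obtain ⟨n, hn⟩ := exists_nat_one_div_lt (half_pos hd)
  have hn0 : (0 : ℝ) < 1 / ((n : ℝ) + 1) := by positivity
  have hcovU : K ⊆ ⋃ j, Metric.ball (x j) (1 / ((n : ℝ) + 1)) := fun y _ => by
    obtain ⟨j, hj⟩ := (TopologicalSpace.denseRange_denseSeq E).exists_dist_lt y hn0
    exact mem_iUnion.2 ⟨j, hj⟩
  obtain ⟨t, ht⟩ := hK.elim_finite_subcover _ (fun j => Metric.isOpen_ball) hcovU
  obtain ⟨N, hN⟩ := t.exists_nat_subset_range
  -- The disjointed cells with indices up to `N` have the same union as the balls with those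
  -- indices.
  have hcov : K ⊆ ⋃ j ∈ Finset.range (N + 1), D n j := fun y hy => by
    obtain ⟨j, hjt, hj⟩ := mem_iUnion₂.1 (ht hy)
    have : y ∈ partialSups (fun j => Metric.ball (x j) (1 / ((n : ℝ) + 1))) N :=
      le_partialSups_of_le (fun j => Metric.ball (x j) (1 / ((n : ℝ) + 1)))
        (Finset.mem_range.1 (hN hjt)).le hj
    rw [← partialSups_disjointed, partialSups_eq_biUnion_range] at this
    exact this
  have hdiff : ∀ i, ∃ n₀, ∀ k ≥ n₀, ∀ l ≥ n₀,
      ∑ j ∈ Finset.range (N + 1),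
        |∫ x in K ∩ D n j, f (φ k) i x ∂μ - ∫ x in K ∩ D n j, f (φ l) i x ∂μ| < η / 2 := by
    intro i
    choose L hL using fun j => hlim ((n, j), i)
    -- The joint limit in both indices is `∑ |L j - L j| = 0`, which is the Cauchy property.
    have h2 : Tendsto (fun p : ℕ × ℕ => ∑ j ∈ Finset.range (N + 1),
        |∫ x in K ∩ D n j, f (φ p.1) i x ∂μ - ∫ x in K ∩ D n j, f (φ p.2) i x ∂μ|)
        (atTop ×ˢ atTop) (𝓝 (∑ j ∈ Finset.range (N + 1), |L j - L j|)) :=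
      tendsto_finsetSum _ fun j _ =>
        (((hL j).comp tendsto_fst).sub ((hL j).comp tendsto_snd)).abs
    simp only [sub_self, abs_zero, Finset.sum_const_zero] at h2
    rw [prod_atTop_atTop_eq] at h2
    obtain ⟨⟨p, q⟩, hpq⟩ := eventually_atTop.1 (h2.eventually_lt_const (half_pos hη))
    exact ⟨max p q, fun k hk l hl =>
      hpq (k, l) ⟨(le_max_left _ _).trans hk, (le_max_right _ _).trans hl⟩⟩
  choose n₀ hn₀ using hdiff
  obtain ⟨n₁, hn₁⟩ := (Set.finite_range n₀).bddAbove
  refine ⟨n₁, fun k hk l hl i => ?_⟩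
  have hle : n₀ i ≤ n₁ := hn₁ (mem_range_self i)
  have hest := setIntegral_abs_le_sum (μ := μ) hK
    (f := fun x => f (φ k) i x - f (φ l) i x) ((hf (φ k) i).sub (hf (φ l) i)) (b := 2 * |b|)
    (fun y hy => ?_) (Finset.range (N + 1)) (hDm n) (disjoint_disjointed _) hcov (d := d) (by linarith) (hDb n)
  · have hs : ∀ j, ∫ x in K ∩ D n j, (f (φ k) i x - f (φ l) i x) ∂μ =
        ∫ x in K ∩ D n j, f (φ k) i x ∂μ - ∫ x in K ∩ D n j, f (φ l) i x ∂μ := fun j =>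
      integral_sub (((hf (φ k) i).integrableOn_compact hK).mono_set inter_subset_left)
        (((hf (φ l) i).integrableOn_compact hK).mono_set inter_subset_left)
    simp only [hs] at hest
    have h1 := hn₀ i k (hle.trans hk) l (hle.trans hl)
    have h2 := ENNReal.toReal_le_of_le_ofReal (by positivity) (hsm (φ k) (φ l) i)
    have h3 : 2 * |b| * μ.real {x ∈ K | Metric.infEDist x
        (frontier {x ∈ K | 0 ≤ f (φ k) i x - f (φ l) i x}) ≤ ENNReal.ofReal d} ≤ η / 2 := by
      calc _ ≤ (2 * |b| + 1) * (η / 2 / (2 * |b| + 1)) := by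
            apply mul_le_mul (by linarith) h2 measureReal_nonneg hB.le
        _ = η / 2 := by field_simp
    exact hest.trans_lt (by linarith)
  · have h1 := hb (φ k) i y hy
    have h2 := hb (φ l) i y hy
    have h3 := abs_sub (f (φ k) i y) (f (φ l) i y)
    linarith [le_abs_self b]

end SignChange

/-! ### Almost everywhere convergence -/

/-- A sequence of integrable functions that is Cauchy in `L¹` has a subsequence converging almost
everywhere. -/
theorem exists_subseq_ae_tendsto_of_integral_norm_sub_lt {X F : Type*} [MeasurableSpace X]
    {ν : Measure X} [NormedAddCommGroup F] [CompleteSpace F] {f : ℕ → X → F}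
    (hf : ∀ k, Integrable (f k) ν)
    (hc : ∀ η : ℝ, 0 < η → ∃ n₀, ∀ k ≥ n₀, ∀ l ≥ n₀, ∫ x, ‖f k x - f l x‖ ∂ν < η) :
    ∃ φ : ℕ → ℕ, StrictMono φ ∧ ∀ᵐ x ∂ν, ∃ L, Tendsto (fun k => f (φ k) x) atTop (𝓝 L) := by
  have hdist : ∀ k l, dist ((hf k).toL1) ((hf l).toL1) = ∫ x, ‖f k x - f l x‖ ∂ν := fun k l => by
    rw [dist_eq_norm, ← Integrable.toL1_sub, L1.norm_eq_integral_norm]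
    refine integral_congr_ae ?_
    filter_upwards [((hf k).sub (hf l)).coeFn_toL1] with x hx
    rw [hx, Pi.sub_apply]
  have hcau : CauchySeq fun k => (hf k).toL1 := Metric.cauchySeq_iff.2 fun η hη => by
    simpa only [hdist] using hc η hη
  obtain ⟨g, hg⟩ := cauchySeq_tendsto_of_complete hcau
  -- Convergence in `L¹` implies convergence in measure, hence almost everywhere along a
  -- subsequence.
  obtain ⟨φ, hφ, hae⟩ := (tendstoInMeasure_of_tendsto_Lp hg).exists_seq_tendsto_ae
  refine ⟨φ, hφ, ?_⟩
  filter_upwards [hae, ae_all_iff.2 fun k => (hf k).coeFn_toL1] with x hx hk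
  exact ⟨g x, by simpa only [hk] using hx⟩

/-- Compactness in the sense of almost everywhere convergence for uniformly bounded continuous
vector-valued functions whose differences have sign sets with uniformly small boundary
neighbourhoods. -/
theorem exists_subseq_ae_tendsto_of_measure_near_frontier_le {E : Type*} [NormedAddCommGroup E]
    [NormedSpace ℝ E] [MeasurableSpace E] [BorelSpace E] [SecondCountableTopology E]
    {μ : Measure E} [IsFiniteMeasureOnCompacts μ] {K : Set E} (hK : IsCompact K) {ι : Type*}
    [Fintype ι] {f : ℕ → E → ι → ℝ} (hf : ∀ k, ContinuousOn (f k) K) {b : ℝ}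
    (hb : ∀ k, ∀ x ∈ K, ∀ i, |f k x i| ≤ b)
    (hsmall : ∀ c : ℝ, 0 < c → ∃ d : ℝ, 0 < d ∧ ∀ k l i,
      μ {x ∈ K | Metric.infEDist x (frontier {x ∈ K | 0 ≤ f k x i - f l x i}) ≤ ENNReal.ofReal d}
        ≤ ENNReal.ofReal c) :
    ∃ φ : ℕ → ℕ, StrictMono φ ∧
      ∀ᵐ x ∂(μ.restrict K), ∃ L, Tendsto (fun k => f (φ k) x) atTop (𝓝 L) := by
  have hfi : ∀ k i, ContinuousOn (fun x => f k x i) K := fun k i => continuousOn_pi.1 (hf k) i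
  obtain ⟨φ, hφ, hc⟩ := exists_subseq_setIntegral_abs_sub_lt (μ := μ) hK
    (f := fun k i x => f k x i) hfi (fun k i x hx => hb k x hx i) hsmall
  have hint : ∀ k, IntegrableOn (f k) K μ := fun k => (hf k).integrableOn_compact hK
  suffices hcau : ∀ η : ℝ, 0 < η → ∃ n₀, ∀ k ≥ n₀, ∀ l ≥ n₀,
      ∫ x in K, ‖f (φ k) x - f (φ l) x‖ ∂μ < η by
    obtain ⟨θ, hθ, hae⟩ := exists_subseq_ae_tendsto_of_integral_norm_sub_lt
      (fun k => hint (φ k)) hcau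
    exact ⟨φ ∘ θ, hφ.comp hθ, hae⟩
  intro η hη
  -- The `+ 1` covers empty `ι` and makes the final inequality strict.
  obtain ⟨n₀, hn₀⟩ := hc (η / (Fintype.card ι + 1)) (by positivity)
  refine ⟨n₀, fun k hk l hl => ?_⟩
  have habs : ∀ i, IntegrableOn (fun x => |f (φ k) x i - f (φ l) x i|) K μ := fun i =>
    ((hfi (φ k) i).sub (hfi (φ l) i)).abs.integrableOn_compact hK
  calc ∫ x in K, ‖f (φ k) x - f (φ l) x‖ ∂μ
      ≤ ∫ x in K, ∑ i, |f (φ k) x i - f (φ l) x i| ∂μ := by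
        refine integral_mono ((hint (φ k)).sub (hint (φ l))).norm
          (integrable_finsetSum _ fun i _ => habs i) fun x => ?_
        exact (pi_norm_le_iff_of_nonneg (Finset.sum_nonneg fun i _ => abs_nonneg _)).2 fun i =>
          Finset.single_le_sum (f := fun i => |f (φ k) x i - f (φ l) x i|)
            (fun i _ => abs_nonneg _) (Finset.mem_univ i)
    _ = ∑ i, ∫ x in K, |f (φ k) x i - f (φ l) x i| ∂μ := integral_finsetSum _ fun i _ => habs i
    _ ≤ ∑ _i : ι, η / (Fintype.card ι + 1) :=
        Finset.sum_le_sum fun i _ => (hn₀ k hk l hl i).le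
    _ < η := by
        rw [Finset.sum_const, Finset.card_univ, nsmul_eq_mul, mul_div_assoc', div_lt_iff₀
          (by positivity)]
        nlinarith

theorem theorem4p4 (m : ℕ) (hm : 0 < m) (D : ResolvedPDE.Data m) (hD : D.Standing)
    (M : ℝ) (hM : 0 < M)
    (h : ∃ (ε : ℕ → ℝ) (Z : ℕ → ResolvedPDE.E3 → Fin 9 × Fin m → ℝ),
      D.IsSolutionSequence M ε Z ∧
      ∀ c : ℝ, 0 < c → ∃ d : ℝ, 0 < d ∧ ∀ (k l : ℕ) (i : Fin 9 × Fin m),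
        volume (D.nearBoundary (D.signPos (Z k) (Z l) i) d ∪
          D.nearBoundary (D.signNeg (Z k) (Z l) i) d) ≤ ENNReal.ofReal c) :
    ∃ (ε : ℕ → ℝ) (Z : ℕ → ResolvedPDE.E3 → Fin 9 × Fin m → ℝ),
      D.IsSolutionSequence M ε Z ∧
      ∀ᵐ X ∂(volume.restrict (closure D.Ω)),
        ∃ L : Fin 9 × Fin m → ℝ, Tendsto (fun k => Z k X) atTop (𝓝 L) := by
  obtain ⟨ε, Z, ⟨hε, hε0, hZ⟩, hsmall⟩ := h
  obtain ⟨φ, hφ, hae⟩ := exists_subseq_ae_tendsto_of_measure_near_frontier_le (μ := volume)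
    hD.bounded.isCompact_closure (fun k => (hZ k).1)
    (fun k X hX i => ((hZ k).2.1 X hX i).le) fun c hc => by
      obtain ⟨d, hd, hle⟩ := hsmall c hc
      -- `nearBoundary` of `signPos` unfolds to exactly the neighbourhood required by the
      -- compactness theorem.
      exact ⟨d, hd, fun k l i => (measure_mono subset_union_left).trans (hle k l i)⟩
  exact ⟨ε ∘ φ, Z ∘ φ,
    ⟨fun k => hε (φ k), hε0.comp hφ.tendsto_atTop, fun k => hZ (φ k)⟩, hae⟩
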